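/- For a finite connected graph $G$ with distance $d$ and an integer $k\ge 1$, let $d_k(x,y)=\min\{d(x,y),k+1\}$. A function $g:V(G)\to[0,1]$ is a resolving function of $G$ if $\sum_{z:\,d(x,z)\ne d(y,z)} g(z)\ge 1$ for all distinct $x,y\in V(G)$, and a $k$-truncated resolving function of $G$ if $\sum_{z:\,d_k(x,z)\ne d_k(y,z)} g(z)\ge 1$ for all distinct $x,y\in V(G)$. Let $\dim_f(G)$ (respectively $\dim_{k,f}(G)$) be the minimum of $\sum_{v\in V(G)} g(v)$ over all resolving (respectively $k$-truncated resolving) functions $g$ of $G$. Let $P_n$ be the path on $n$ vertices and $\times$ the Cartesian product of graphs. **Theorem.** For integers $k>1$ let $G_k=P_{(2k+2)^2}\times P_{(2k+1)^2}$. Then: 1. $\dim_{k,f}(G_k)=\Theta(k^2)$, i.e. there are constants $c,C>0$ such that $ck^2\le\dim_{k,f}(G_k)\le Ck^2$ for all $k>1$; 2. $\dim_f(G_k)=2$ for all $k>1$; 3. $\dim_{1,f}(G_k)=\Theta(k^4)$, i.e. there are constants $c',C'>0$ such that $c'k^4\le\dim_{1,f}(G_k)\le C'k^4$ for all $k>1$;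 4. consequently both ratios $\dim_{1,f}(G_k)/\dim_{k,f}(G_k)$ and $\dim_{k,f}(G_k)/\dim_f(G_k)$ can be arbitrarily large: for every real $M$ there is a $k>1$ for which both ratios exceed $M$. -/

import Mathlib

open scoped SimpleGraph

namespace SimpleGraph

section FractionalDimension

variable {V : Type*} [Fintype V]

/-- The truncated distance `d_k(x, y) = min {d(x, y), k + 1}` of a connected graph. -/
noncomputable def truncDist (G : SimpleGraph V) (k : ℕ) (x y : V) : ℕ :=
  min (G.dist x y) (k + 1)

/-- `R{x, y}`: the vertices whose distances to `x` and to `y` differ. -/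
noncomputable def resolvers (G : SimpleGraph V) (x y : V) : Finset V :=
  Finset.univ.filter fun z => G.dist x z ≠ G.dist y z

/-- `R_k{x, y}`: the vertices whose `k`-truncated distances to `x` and to `y` differ. -/
noncomputable def truncResolvers (G : SimpleGraph V) (k : ℕ) (x y : V) : Finset V :=
  Finset.univ.filter fun z => G.truncDist k x z ≠ G.truncDist k y z

/-- `g : V → [0, 1]` is a resolving function of `G`. -/
def IsResolvingFunction (G : SimpleGraph V) (g : V → ℝ) : Prop :=
  (∀ v, g v ∈ Set.Icc (0 : ℝ) 1) ∧
    ∀ x y, x ≠ y → 1 ≤ ∑ z ∈ G.resolvers x y, g z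

/-- `g : V → [0, 1]` is a `k`-truncated resolving function of `G`. -/
def IsTruncResolvingFunction (G : SimpleGraph V) (k : ℕ) (g : V → ℝ) : Prop :=
  (∀ v, g v ∈ Set.Icc (0 : ℝ) 1) ∧
    ∀ x y, x ≠ y → 1 ≤ ∑ z ∈ G.truncResolvers k x y, g z

/-- The fractional metric dimension `dim_f(G)`: the minimum of `g(V)` over the resolving functions
`g` of `G` (the minimum is attained, see `fracDim_isLeast`). -/
noncomputable def fracDim (G : SimpleGraph V) : ℝ :=
  sInf {r | ∃ g, G.IsResolvingFunction g ∧ r = ∑ v, g v}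

/-- The fractional `k`-truncated metric dimension `dim_{k,f}(G)`: the minimum of `g(V)` over the
`k`-truncated resolving functions `g` of `G` (attained, see `truncFracDim_isLeast`). -/
noncomputable def truncFracDim (G : SimpleGraph V) (k : ℕ) : ℝ :=
  sInf {r | ∃ g, G.IsTruncResolvingFunction k g ∧ r = ∑ v, g v}

/-- A linear program of this shape attains its minimum. -/
theorem isLeast_sInf_of_resolvers (R : V → V → Finset V) (hR : ∀ x y, x ≠ y → x ∈ R x y) :
    IsLeast {r : ℝ | ∃ g : V → ℝ, ((∀ v, g v ∈ Set.Icc (0 : ℝ) 1) ∧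
        ∀ x y, x ≠ y → 1 ≤ ∑ z ∈ R x y, g z) ∧ r = ∑ v, g v}
      (sInf {r : ℝ | ∃ g : V → ℝ, ((∀ v, g v ∈ Set.Icc (0 : ℝ) 1) ∧
        ∀ x y, x ≠ y → 1 ≤ ∑ z ∈ R x y, g z) ∧ r = ∑ v, g v}) := by
  set F : Set (V → ℝ) := (Set.univ.pi fun _ => Set.Icc (0 : ℝ) 1) ∩
    ⋂ (x : V) (y : V) (_ : x ≠ y), {g | 1 ≤ ∑ z ∈ R x y, g z} with hF
  have hS : {r : ℝ | ∃ g : V → ℝ, ((∀ v, g v ∈ Set.Icc (0 : ℝ) 1) ∧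
        ∀ x y, x ≠ y → 1 ≤ ∑ z ∈ R x y, g z) ∧ r = ∑ v, g v} =
      (fun g : V → ℝ => ∑ v, g v) '' F := by
    ext r
    simp only [hF, Set.mem_ofPred_eq, Set.mem_image, Set.mem_inter_iff, Set.mem_pi, Set.mem_univ,
      true_implies, Set.mem_iInter, eq_comm]
  have hc : IsCompact F := by
    refine (isCompact_univ_pi fun _ => isCompact_Icc).inter_right ?_
    refine isClosed_iInter fun x => isClosed_iInter fun y => isClosed_iInter fun _ => ?_
    exact isClosed_le continuous_const (by fun_prop)
  have hne : F.Nonempty := by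
    refine ⟨fun _ => 1, fun _ _ => ⟨zero_le_one, le_rfl⟩, ?_⟩
    simp only [Set.mem_iInter, Set.mem_ofPred_eq]
    intro x y hxy
    have := Finset.card_pos.2 ⟨x, hR x y hxy⟩
    simp only [Finset.sum_const, nsmul_eq_mul, mul_one]
    exact_mod_cast this
  rw [hS]
  exact (hc.image (by fun_prop)).isLeast_sInf (hne.image _)

theorem fracDim_isLeast (G : SimpleGraph V) (hG : G.Connected) :
    IsLeast {r | ∃ g, G.IsResolvingFunction g ∧ r = ∑ v, g v} G.fracDim := by
  refine isLeast_sInf_of_resolvers G.resolvers fun x y hxy => ?_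
  have := hG.pos_dist_of_ne hxy.symm
  simp only [resolvers, Finset.mem_filter, Finset.mem_univ, true_and, dist_self]
  omega

theorem truncFracDim_isLeast (G : SimpleGraph V) (hG : G.Connected) (k : ℕ) :
    IsLeast {r | ∃ g, G.IsTruncResolvingFunction k g ∧ r = ∑ v, g v} (G.truncFracDim k) := by
  refine isLeast_sInf_of_resolvers (G.truncResolvers k) fun x y hxy => ?_
  have := hG.pos_dist_of_ne hxy.symm
  refine Finset.mem_filter.2 ⟨Finset.mem_univ _, ?_⟩
  simp only [truncDist, dist_self]
  omega

end FractionalDimension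

/-- The grid graph `P_s × P_t`: the Cartesian product of the paths on `s` and on `t` vertices. -/
def gridGraph (s t : ℕ) : SimpleGraph (Fin s × Fin t) :=
  pathGraph s □ pathGraph t

end SimpleGraph

namespace SimpleGraph

/-! ### Linear programming bounds for the truncated dimension. -/

section General

variable {V : Type*} [Fintype V]

/-! Truncation localises resolution: `z` can separate `x` and `y` only if it lies within `k` of one
of them. Hence adjacent pairs centred in disjoint blocks of side `2k+2` each need their own unit of
weight (`le_truncFracDim_gridGraph`), while landmarks about `k/2` apart resolve everything
(`truncFracDim_gridGraph_le`). With sides of order `k ^ 2`, both counts are of order `k ^ 2`; for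
truncation at 1 the blocks have side 4, so the order is that of the number of vertices, `k ^ 4`.
Without truncation, the four corners with weight 1/2 suffice, and the diagonal pairs at the corners
show that 2 is optimal. -/

/-- An indicator function of a `k`-truncated resolving set bounds the fractional dimension. -/
theorem truncFracDim_le_card (G : SimpleGraph V) (hG : G.Connected) (k : ℕ) (S : Finset V)
    (hS : ∀ x y, x ≠ y → ∃ z ∈ S, G.truncDist k x z ≠ G.truncDist k y z) :
    G.truncFracDim k ≤ S.card := by
  classical
  refine (G.truncFracDim_isLeast hG k).2 ⟨fun v => if v ∈ S then 1 else 0, ⟨fun v => ?_, ?_⟩, ?_⟩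
  · dsimp only
    split_ifs <;> simp
  · intro x y hxy
    obtain ⟨z, hzS, hz⟩ := hS x y hxy
    have hmem : z ∈ G.truncResolvers k x y := by simpa [truncResolvers] using hz
    have := Finset.single_le_sum (f := fun v => if v ∈ S then (1 : ℝ) else 0)
      (fun v _ => by split_ifs <;> simp) hmem
    simpa [hzS] using this
  · simp

/-- A family of pairs with pairwise disjoint resolving neighbourhoods, separated by a labelling `c`
of the vertices, bounds the fractional `k`-truncated dimension from below. -/
theorem card_le_truncFracDim (G : SimpleGraph V) (hG : G.Connected) (k : ℕ) {ι : Type*}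
    (I : Finset ι) (x y : ι → V) (c : V → ι) (hxy : ∀ i ∈ I, x i ≠ y i)
    (hc : ∀ i ∈ I, ∀ z, G.truncDist k (x i) z ≠ G.truncDist k (y i) z → c z = i) :
    (I.card : ℝ) ≤ G.truncFracDim k := by
  classical
  obtain ⟨g, ⟨hg, hres⟩, hsum⟩ := (G.truncFracDim_isLeast hG k).1
  have hmem : ∀ i ∈ I, ∀ z ∈ G.truncResolvers k (x i) (y i), c z = i := fun i hi z hz =>
    hc i hi z (by simpa [truncResolvers] using hz)
  have hdisj : (I : Set ι).PairwiseDisjoint fun i => G.truncResolvers k (x i) (y i) := by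
    intro i hi j hj hij
    refine Finset.disjoint_left.2 fun z hzi hzj => hij ?_
    rw [← hmem i hi z hzi, hmem j hj z hzj]
  calc (I.card : ℝ) = ∑ _i ∈ I, (1 : ℝ) := by simp
    _ ≤ ∑ i ∈ I, ∑ z ∈ G.truncResolvers k (x i) (y i), g z :=
        Finset.sum_le_sum fun i hi => hres _ _ (hxy i hi)
    _ = ∑ z ∈ I.biUnion fun i => G.truncResolvers k (x i) (y i), g z :=
        (Finset.sum_biUnion hdisj).symm
    _ ≤ ∑ z, g z := Finset.sum_le_sum_of_subset_of_nonneg (Finset.subset_univ _)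
        fun z _ _ => (hg z).1
    _ = G.truncFracDim k := hsum.symm

theorem truncFracDim_le_card_univ (G : SimpleGraph V) (hG : G.Connected) (k : ℕ) :
    G.truncFracDim k ≤ Fintype.card V := by
  refine G.truncFracDim_le_card hG k Finset.univ fun x y hxy => ⟨x, Finset.mem_univ _, ?_⟩
  have := hG.pos_dist_of_ne hxy.symm
  simp only [truncDist, dist_self]
  omega

end General

/-! ### Distances, packings and landmarks in grids. -/

section Grid

/-- Each step changes the coordinate by one. The sum of two truncated subtractions is the absolute
difference, in a form `omega` handles. -/
theorem pathGraph_walk_length {n : ℕ} {u v : Fin n} (p : (pathGraph n).Walk u v) :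
    (u.val - v.val) + (v.val - u.val) ≤ p.length := by
  induction p with
  | nil => simp
  | cons h p ih =>
    rw [pathGraph_adj] at h
    rw [Walk.length_cons]
    omega

theorem exists_pathGraph_walk {n : ℕ} (d : ℕ) (u v : Fin n) (h : u.val + d = v.val) :
    ∃ p : (pathGraph n).Walk u v, p.length = d := by
  induction d generalizing u with
  | zero =>
    obtain rfl : u = v := Fin.ext h
    exact ⟨Walk.nil, rfl⟩
  | succ d ih =>
    obtain ⟨p, hp⟩ := ih ⟨u.val + 1, by omega⟩ (by simp only; omega)
    exact ⟨Walk.cons (pathGraph_adj.2 (Or.inl rfl)) p, by simp [hp]⟩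

theorem pathGraph_dist {n : ℕ} (u v : Fin n) :
    (pathGraph n).dist u v = (u.val - v.val) + (v.val - u.val) := by
  apply le_antisymm
  · rcases le_total u.val v.val with h | h
    · obtain ⟨p, hp⟩ := exists_pathGraph_walk (v.val - u.val) u v (by omega)
      have := dist_le p
      omega
    · obtain ⟨p, hp⟩ := exists_pathGraph_walk (u.val - v.val) v u (by omega)
      have := dist_le p
      rw [dist_comm]
      omega
  · obtain ⟨p, hp⟩ := (pathGraph_preconnected n u v).exists_walk_length_eq_dist
    rw [← hp]
    exact pathGraph_walk_length p

theorem gridGraph_connected {s t : ℕ} (hs : 0 < s) (ht : 0 < t) : (gridGraph s t).Connected := by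
  obtain ⟨s, rfl⟩ := Nat.exists_eq_succ_of_ne_zero hs.ne'
  obtain ⟨t, rfl⟩ := Nat.exists_eq_succ_of_ne_zero ht.ne'
  exact (pathGraph_connected s).boxProd (pathGraph_connected t)

theorem gridGraph_dist {s t : ℕ} (x y : Fin s × Fin t) :
    (gridGraph s t).dist x y =
      (x.1.val - y.1.val) + (y.1.val - x.1.val) + ((x.2.val - y.2.val) + (y.2.val - x.2.val)) := by
  rw [gridGraph, ← pathGraph_dist, ← pathGraph_dist, dist, edist_boxProd, ENat.toNat_add
    (edist_ne_top_iff_reachable.2 (pathGraph_preconnected s _ _))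
    (edist_ne_top_iff_reachable.2 (pathGraph_preconnected t _ _)), dist, dist]

/-- Block packing: the centre pairs of blocks of side `2 r + 2` have disjoint resolvers. -/
theorem le_truncFracDim_gridGraph {s t : ℕ} (hs : 0 < s) (ht : 0 < t) (r : ℕ) :
    ((s / (2 * r + 2) * (t / (2 * r + 2)) : ℕ) : ℝ) ≤ (gridGraph s t).truncFracDim r := by
  set L := 2 * r + 2 with hL
  have hLpos : 0 < L := by omega
  have key : ∀ n i : ℕ, i < n / L → L * i + L ≤ n := fun n i hi =>
    calc L * i + L = L * (i + 1) := by ring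
      _ ≤ L * (n / L) := Nat.mul_le_mul_left _ hi
      _ ≤ n := Nat.mul_div_le n L
  have := (gridGraph s t).card_le_truncFracDim (gridGraph_connected hs ht) r
    (Finset.range (s / L) ×ˢ Finset.range (t / L))
    -- The remainders only make the family total; for indices in the range they change nothing.
    (fun i => (⟨(L * i.1 + r) % s, Nat.mod_lt _ hs⟩, ⟨(L * i.2 + r) % t, Nat.mod_lt _ ht⟩))
    (fun i => (⟨(L * i.1 + r) % s, Nat.mod_lt _ hs⟩, ⟨(L * i.2 + r + 1) % t, Nat.mod_lt _ ht⟩))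
    (fun z => (z.1.val / L, z.2.val / L)) ?_ ?_
  · simpa using this
  · rintro ⟨a, b⟩ hi
    rw [Finset.mem_product, Finset.mem_range, Finset.mem_range] at hi
    have hb := key t b hi.2
    simp only [ne_eq, Prod.mk.injEq, Fin.mk.injEq, true_and]
    rw [Nat.mod_eq_of_lt (by omega), Nat.mod_eq_of_lt (by omega)]
    omega
  · rintro ⟨a, b⟩ hi z hz
    rw [Finset.mem_product, Finset.mem_range, Finset.mem_range] at hi
    have ha := key s a hi.1
    have hb := key t b hi.2
    simp only [truncDist, gridGraph_dist] at hz
    rw [Nat.mod_eq_of_lt (by omega : L * a + r < s), Nat.mod_eq_of_lt (by omega : L * b + r < t),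
      Nat.mod_eq_of_lt (by omega : L * b + r + 1 < t)] at hz
    -- A resolving `z` is within `r` of one of the two centres, and the block contains both balls.
    have h1 : L * a ≤ z.1.val ∧ z.1.val < L * a + L := by omega
    have h2 : L * b ≤ z.2.val ∧ z.2.val < L * b + L := by omega
    refine Prod.ext ?_ ?_
    · exact Nat.div_eq_of_lt_le (by rw [mul_comm]; exact h1.1)
        (by rw [mul_comm, mul_add, mul_one]; exact h1.2)
    · exact Nat.div_eq_of_lt_le (by rw [mul_comm]; exact h2.1)
        (by rw [mul_comm, mul_add, mul_one]; exact h2.2)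

/-- A point of a rectangle is determined by its `ℓ¹` distances to three of the corners. -/
theorem eq_of_corner_dist {p p' q q' x₁ x₂ y₁ y₂ : ℕ} (hx₁ : p ≤ x₁ ∧ x₁ ≤ p')
    (hx₂ : q ≤ x₂ ∧ x₂ ≤ q')
    (h₁ : (y₁ - p) + (p - y₁) + ((y₂ - q) + (q - y₂)) = (x₁ - p) + (x₂ - q))
    (h₂ : (y₁ - p') + (p' - y₁) + ((y₂ - q) + (q - y₂)) = (p' - x₁) + (x₂ - q))
    (h₃ : (y₁ - p) + (p - y₁) + ((y₂ - q') + (q' - y₂)) = (x₁ - p) + (q' - x₂)) :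
    x₁ = y₁ ∧ x₂ = y₂ := by
  -- Triangle inequality on a line, with equality only for `y` between the endpoints. Adding `h₂`
  -- and `h₃` forces equality in both coordinates; then `h₁` fixes the coordinate sum and `h₂` the
  -- difference.
  have aux : ∀ {a b y d e : ℕ}, a ≤ b → (y - a) + (a - y) = d → (y - b) + (b - y) = e →
      b ≤ a + d + e ∧ (d + e + a ≤ b → a ≤ y ∧ y ≤ b ∧ y = a + d) := by omega
  obtain ⟨m₁, k₁⟩ := aux (hx₁.1.trans hx₁.2) (y := y₁) rfl rfl
  obtain ⟨m₂, k₂⟩ := aux (hx₂.1.trans hx₂.2) (y := y₂) rfl rfl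
  generalize (y₁ - p) + (p - y₁) = a at *
  generalize (y₁ - p') + (p' - y₁) = b at *
  generalize (y₂ - q) + (q - y₂) = c at *
  generalize (y₂ - q') + (q' - y₂) = d at *
  have := k₁ (by omega)
  have := k₂ (by omega)
  omega

/-- Landmarks spaced at distance `m` in both directions form a `k`-truncated resolving set when
`2 m ≤ k`. -/
theorem truncFracDim_gridGraph_le {s t : ℕ} (hs : 0 < s) (ht : 0 < t) {k m : ℕ} (hm : 0 < m)
    (hk : 2 * m ≤ k) :
    (gridGraph s t).truncFracDim k ≤ (((s / m + 2) * (t / m + 2) : ℕ) : ℝ) := by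
  classical
  -- Clamping keeps the far corners of the last cells inside the grid; these corners have index up
  -- to `s / m + 1`, hence the `+ 2` in the ranges.
  set f : ℕ × ℕ → Fin s × Fin t := fun i =>
    (⟨min (m * i.1) (s - 1), by omega⟩, ⟨min (m * i.2) (t - 1), by omega⟩) with hf
  set S := (Finset.range (s / m + 2) ×ˢ Finset.range (t / m + 2)).image f with hS
  have hcard : S.card ≤ (s / m + 2) * (t / m + 2) := by
    refine Finset.card_image_le.trans ?_
    simp
  refine ((gridGraph s t).truncFracDim_le_card (gridGraph_connected hs ht) k S ?_).trans
    (by exact_mod_cast hcard)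
  intro x y hxy
  by_contra! hcon
  have hbound : ∀ {n : ℕ} (a : Fin n), m * (a.val / m) ≤ a.val ∧ a.val < m * (a.val / m + 1) ∧
      a.val / m ≤ n / m := fun a =>
    ⟨Nat.mul_div_le _ _, Nat.lt_mul_div_succ _ hm, Nat.div_le_div_right a.isLt.le⟩
  obtain ⟨h1, h2, h3⟩ := hbound x.1
  obtain ⟨h4, h5, h6⟩ := hbound x.2
  have hmem : ∀ i j, i < s / m + 2 → j < t / m + 2 → f (i, j) ∈ S := fun i j hi hj =>
    Finset.mem_image_of_mem f (Finset.mem_product.2 ⟨Finset.mem_range.2 hi, Finset.mem_range.2 hj⟩)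
  have e1 := hcon _ (hmem (x.1.val / m) (x.2.val / m) (by omega) (by omega))
  have e2 := hcon _ (hmem (x.1.val / m + 1) (x.2.val / m) (by omega) (by omega))
  have e3 := hcon _ (hmem (x.1.val / m) (x.2.val / m + 1) (by omega) (by omega))
  simp only [hf, truncDist, gridGraph_dist, mul_add, mul_one] at e1 e2 e3 h2 h5
  clear hmem hcon hcard
  have hx1 := x.1.isLt
  have hx2 := x.2.isLt
  have hne : ¬ (x.1.val = y.1.val ∧ x.2.val = y.2.val) := fun h =>
    hxy (Prod.ext (Fin.ext h.1) (Fin.ext h.2))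
  generalize m * (x.1.val / m) = p at e1 e2 e3 h1 h2
  generalize m * (x.2.val / m) = q at e1 e2 e3 h4 h5
  have hp : p ≤ s - 1 := by clear e1 e2 e3; omega
  have hq : q ≤ t - 1 := by clear e1 e2 e3; omega
  obtain ⟨p', hp', hp1, hp2⟩ : ∃ p', min (p + m) (s - 1) = p' ∧ x.1.val ≤ p' ∧ p' ≤ p + m :=
    ⟨_, rfl, by clear e1 e2 e3; omega, min_le_left _ _⟩
  obtain ⟨q', hq', hq1, hq2⟩ : ∃ q', min (q + m) (t - 1) = q' ∧ x.2.val ≤ q' ∧ q' ≤ q + m :=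
    ⟨_, rfl, by clear e1 e2 e3; omega, min_le_left _ _⟩
  simp only [hp', hq', min_eq_left hp, min_eq_left hq] at e1 e2 e3
  rw [Nat.sub_eq_zero_of_le h1, Nat.sub_eq_zero_of_le h4] at e1
  rw [Nat.sub_eq_zero_of_le hp1, Nat.sub_eq_zero_of_le h4] at e2
  rw [Nat.sub_eq_zero_of_le h1, Nat.sub_eq_zero_of_le hq1] at e3
  simp only [add_zero, zero_add] at e1 e2 e3
  -- Corners of the cell of `x` are within `2 * m ≤ k` of `x`, so truncation loses nothing there.
  have hd : ∀ {a b : ℕ}, min a (k + 1) = min b (k + 1) → a ≤ k → b = a := by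
    clear e1 e2 e3
    omega
  refine hne (eq_of_corner_dist ⟨h1, hp1⟩ ⟨h4, hq1⟩ (hd e1 ?_) (hd e2 ?_) (hd e3 ?_)) <;>
    clear e1 e2 e3 hd <;> omega

/-- Half the indicator of the four corners is a resolving function. -/
theorem fracDim_gridGraph_le {s t : ℕ} (hs : 2 ≤ s) (ht : 2 ≤ t) : (gridGraph s t).fracDim ≤ 2 := by
  classical
  have hG : (gridGraph s t).Connected := gridGraph_connected (by omega) (by omega)
  set A : Fin s × Fin t := (⟨0, by omega⟩, ⟨0, by omega⟩) with hA
  set B : Fin s × Fin t := (⟨s - 1, by omega⟩, ⟨0, by omega⟩) with hB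
  set C : Fin s × Fin t := (⟨0, by omega⟩, ⟨t - 1, by omega⟩) with hC
  set D : Fin s × Fin t := (⟨s - 1, by omega⟩, ⟨t - 1, by omega⟩) with hD
  have hAD : A ≠ D := by
    simp only [hA, hD, ne_eq, Prod.mk.injEq, Fin.mk.injEq]
    omega
  have hBC : B ≠ C := by
    simp only [hB, hC, ne_eq, Prod.mk.injEq, Fin.mk.injEq]
    omega
  set K : Finset (Fin s × Fin t) := {A, B, C, D} with hK
  set g : Fin s × Fin t → ℝ := fun v => if v ∈ K then 1 / 2 else 0 with hg
  have hg0 : ∀ v, 0 ≤ g v := fun v => by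
    simp only [hg]
    split_ifs <;> norm_num
  have hgK : ∀ v ∈ K, g v = 1 / 2 := fun v hv => by simp [hg, hv]
  have hmem : IsLeast _ _ := (gridGraph s t).fracDim_isLeast hG
  refine (hmem.2 ⟨g, ⟨fun v => ⟨hg0 v, ?_⟩, fun x y hxy => ?_⟩, rfl⟩).trans ?_
  · simp only [hg]
    split_ifs <;> norm_num
  · have pair : ∀ u ∈ K, ∀ v ∈ K, u ≠ v → u ∈ (gridGraph s t).resolvers x y →
        v ∈ (gridGraph s t).resolvers x y → 1 ≤ ∑ z ∈ (gridGraph s t).resolvers x y, g z := by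
      intro u hu v hv huv hux hvx
      have hsub : ({u, v} : Finset (Fin s × Fin t)) ⊆ (gridGraph s t).resolvers x y := by
        intro w hw
        rcases Finset.mem_insert.1 hw with rfl | hw
        · exact hux
        · rw [Finset.mem_singleton.1 hw]
          exact hvx
      have h := Finset.sum_le_sum_of_subset_of_nonneg hsub fun z _ _ => hg0 z
      rw [Finset.sum_pair huv, hgK u hu, hgK v hv] at h
      linarith
    have hne : ¬ (x.1.val = y.1.val ∧ x.2.val = y.2.val) := fun h =>
      hxy (Prod.ext (Fin.ext h.1) (Fin.ext h.2))
    have hx1 := x.1.isLt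
    have hx2 := x.2.isLt
    have hy1 := y.1.isLt
    have hy2 := y.2.isLt
    -- `A` and `D` see the coordinate sum, `B` and `C` the difference; distinct points differ in one
    -- of them.
    by_cases h : x.1.val + x.2.val = y.1.val + y.2.val
    · refine pair B (by simp [hK]) C (by simp [hK]) hBC ?_ ?_ <;>
        simp only [resolvers, Finset.mem_filter, Finset.mem_univ, true_and, gridGraph_dist, hB,
          hC] <;> omega
    · refine pair A (by simp [hK]) D (by simp [hK]) hAD ?_ ?_ <;>
        simp only [resolvers, Finset.mem_filter, Finset.mem_univ, true_and, gridGraph_dist, hA,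
          hD] <;> omega
  · have hcard : (K.card : ℝ) ≤ 4 := by exact_mod_cast Finset.card_le_four
    calc ∑ v, g v = K.card * (1 / 2) := by simp [hg]
      _ ≤ 2 := by linarith

/-- The diagonal pairs at the four corners are resolved only along the boundary, and every vertex
resolves at most two of them. -/
theorem le_fracDim_gridGraph {s t : ℕ} (hs : 2 ≤ s) (ht : 2 ≤ t) :
    2 ≤ (gridGraph s t).fracDim := by
  classical
  have hG : (gridGraph s t).Connected := gridGraph_connected (by omega) (by omega)
  have hmem : IsLeast _ _ := (gridGraph s t).fracDim_isLeast hG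
  obtain ⟨g, ⟨hg, hres⟩, hsum⟩ := hmem.1
  have hA := hres (⟨1, by omega⟩, ⟨0, by omega⟩) (⟨0, by omega⟩, ⟨1, by omega⟩) (by simp)
  have hB := hres (⟨s - 2, by omega⟩, ⟨0, by omega⟩) (⟨s - 1, by omega⟩, ⟨1, by omega⟩) (by simp)
  have hC := hres (⟨1, by omega⟩, ⟨t - 1, by omega⟩) (⟨0, by omega⟩, ⟨t - 2, by omega⟩) (by simp)
  have hD := hres (⟨s - 2, by omega⟩, ⟨t - 1, by omega⟩) (⟨s - 1, by omega⟩, ⟨t - 2, by omega⟩)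
    (by simp only [ne_eq, Prod.mk.injEq, Fin.mk.injEq]; omega)
  rw [resolvers, Finset.sum_filter] at hA hB hC hD
  have hle : ∑ z, (2 * g z) = 2 * (gridGraph s t).fracDim := by rw [← Finset.mul_sum, hsum]
  have h4 := add_le_add (add_le_add hA hB) (add_le_add hC hD)
  rw [← Finset.sum_add_distrib, ← Finset.sum_add_distrib, ← Finset.sum_add_distrib] at h4
  have h2 := h4.trans (Finset.sum_le_sum (g := fun z => 2 * g z) fun z _ => ?_)
  · rw [hle] at h2
    linarith
  · have h0 := (hg z).1
    have hz1 := z.1.isLt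
    have hz2 := z.2.isLt
    simp only [gridGraph_dist]
    generalize z.1.val = a at *
    generalize z.2.val = b at *
    -- A corner's diagonal pair is resolved exactly by the vertices on one, but not both, of the two
    -- sides meeting there.
    have cA : 1 - a + (a - 1) + (0 - b + (b - 0)) ≠ 0 - a + (a - 0) + (1 - b + (b - 1)) ↔
        (a = 0 ↔ b ≠ 0) := by omega
    have cB : s - 2 - a + (a - (s - 2)) + (0 - b + (b - 0)) ≠
        s - 1 - a + (a - (s - 1)) + (1 - b + (b - 1)) ↔ (a = s - 1 ↔ b ≠ 0) := by omega
    have cC : 1 - a + (a - 1) + (t - 1 - b + (b - (t - 1))) ≠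
        0 - a + (a - 0) + (t - 2 - b + (b - (t - 2))) ↔ (a = 0 ↔ b ≠ t - 1) := by omega
    have cD : s - 2 - a + (a - (s - 2)) + (t - 1 - b + (b - (t - 1))) ≠
        s - 1 - a + (a - (s - 1)) + (t - 2 - b + (b - (t - 2))) ↔ (a = s - 1 ↔ b ≠ t - 1) := by
      omega
    simp only [cA, cB, cC, cD]
    clear cA cB cC cD
    split_ifs <;> first | linarith | (exfalso; omega)

theorem fracDim_gridGraph {s t : ℕ} (hs : 2 ≤ s) (ht : 2 ≤ t) : (gridGraph s t).fracDim = 2 :=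
  le_antisymm (fracDim_gridGraph_le hs ht) (le_fracDim_gridGraph hs ht)

end Grid

/-! ### Explicit constants for the grids of the theorem. -/

section Squares

variable (k : ℕ)

theorem le_truncFracDim_squareGrid :
    4 * (k : ℝ) ^ 2 ≤ (gridGraph ((2 * k + 2) ^ 2) ((2 * k + 1) ^ 2)).truncFracDim k := by
  refine le_trans ?_ (le_truncFracDim_gridGraph (by positivity) (by positivity) k)
  have h1 : 2 * k ≤ (2 * k + 2) ^ 2 / (2 * k + 2) :=
    (Nat.le_div_iff_mul_le (by omega)).2 (by nlinarith)
  have h2 : 2 * k ≤ (2 * k + 1) ^ 2 / (2 * k + 2) :=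
    (Nat.le_div_iff_mul_le (by omega)).2 (by nlinarith)
  have h3 : 4 * k ^ 2 ≤ (2 * k + 2) ^ 2 / (2 * k + 2) * ((2 * k + 1) ^ 2 / (2 * k + 2)) :=
    le_trans (by nlinarith) (Nat.mul_le_mul h1 h2)
  exact_mod_cast h3

theorem le_truncFracDim_one_squareGrid :
    (k : ℝ) ^ 4 ≤ (gridGraph ((2 * k + 2) ^ 2) ((2 * k + 1) ^ 2)).truncFracDim 1 := by
  refine le_trans ?_ (le_truncFracDim_gridGraph (by positivity) (by positivity) 1)
  have h1 : k ^ 2 ≤ (2 * k + 2) ^ 2 / (2 * 1 + 2) :=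
    (Nat.le_div_iff_mul_le (by omega)).2 (by nlinarith [Nat.zero_le k])
  have h2 : k ^ 2 ≤ (2 * k + 1) ^ 2 / (2 * 1 + 2) :=
    (Nat.le_div_iff_mul_le (by omega)).2 (by nlinarith [Nat.zero_le k])
  have h3 : k ^ 4 ≤ (2 * k + 2) ^ 2 / (2 * 1 + 2) * ((2 * k + 1) ^ 2 / (2 * 1 + 2)) :=
    le_trans (by rw [← pow_add]) (Nat.mul_le_mul h1 h2)
  exact_mod_cast h3

variable {k}

theorem truncFracDim_squareGrid_le (hk : 1 < k) :
    (gridGraph ((2 * k + 2) ^ 2) ((2 * k + 1) ^ 2)).truncFracDim k ≤ 784 * (k : ℝ) ^ 2 := by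
  refine (truncFracDim_gridGraph_le (m := k / 2) (by positivity) (by positivity) (by omega)
    (by omega)).trans ?_
  have hm : k ≤ 3 * (k / 2) := by omega
  -- Both sides of the grid are at most `(3 * k) ^ 2` since `k ≥ 2`; the final constant is `784 = 28
  -- ^ 2`.
  have hdiv : ∀ n, n ≤ 9 * k ^ 2 → n / (k / 2) + 2 ≤ 28 * k := by
    intro n hn
    have : n / (k / 2) ≤ 27 * k := Nat.div_le_of_le_mul (by nlinarith)
    omega
  have h3 := Nat.mul_le_mul (hdiv ((2 * k + 2) ^ 2) (by nlinarith))
    (hdiv ((2 * k + 1) ^ 2) (by nlinarith))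
  refine (Nat.cast_le (α := ℝ).2 h3).trans (le_of_eq ?_)
  push_cast
  ring

theorem truncFracDim_one_squareGrid_le (hk : 1 < k) :
    (gridGraph ((2 * k + 2) ^ 2) ((2 * k + 1) ^ 2)).truncFracDim 1 ≤ 81 * (k : ℝ) ^ 4 := by
  refine (truncFracDim_le_card_univ _ (gridGraph_connected (by positivity) (by positivity)) 1).trans
    ?_
  have h3 := Nat.mul_le_mul (show (2 * k + 2) ^ 2 ≤ 9 * k ^ 2 by nlinarith)
    (show (2 * k + 1) ^ 2 ≤ 9 * k ^ 2 by nlinarith)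
  rw [Fintype.card_prod, Fintype.card_fin, Fintype.card_fin]
  refine (Nat.cast_le (α := ℝ).2 h3).trans (le_of_eq ?_)
  push_cast
  ring

end Squares

end SimpleGraph

theorem mainTheorem6 :
    -- `dim_{k,f}(G) = Θ(k ^ 2)`
    (∃ c C : ℝ, 0 < c ∧ 0 < C ∧ ∀ k : ℕ, 1 < k →
      c * (k : ℝ) ^ 2 ≤
          (SimpleGraph.gridGraph ((2 * k + 2) ^ 2) ((2 * k + 1) ^ 2)).truncFracDim k ∧
        (SimpleGraph.gridGraph ((2 * k + 2) ^ 2) ((2 * k + 1) ^ 2)).truncFracDim k ≤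
          C * (k : ℝ) ^ 2) ∧
    -- `dim_f(G) = 2`
    (∀ k : ℕ, 1 < k →
      (SimpleGraph.gridGraph ((2 * k + 2) ^ 2) ((2 * k + 1) ^ 2)).fracDim = 2) ∧
    -- `dim_{1,f}(G) = Θ(k ^ 4)`
    (∃ c C : ℝ, 0 < c ∧ 0 < C ∧ ∀ k : ℕ, 1 < k →
      c * (k : ℝ) ^ 4 ≤
          (SimpleGraph.gridGraph ((2 * k + 2) ^ 2) ((2 * k + 1) ^ 2)).truncFracDim 1 ∧
        (SimpleGraph.gridGraph ((2 * k + 2) ^ 2) ((2 * k + 1) ^ 2)).truncFracDim 1 ≤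
          C * (k : ℝ) ^ 4) ∧
    -- both ratios are arbitrarily large
    (∀ M : ℝ, ∃ k : ℕ, 1 < k ∧
      M < (SimpleGraph.gridGraph ((2 * k + 2) ^ 2) ((2 * k + 1) ^ 2)).truncFracDim 1 /
          (SimpleGraph.gridGraph ((2 * k + 2) ^ 2) ((2 * k + 1) ^ 2)).truncFracDim k ∧
      M < (SimpleGraph.gridGraph ((2 * k + 2) ^ 2) ((2 * k + 1) ^ 2)).truncFracDim k /
          (SimpleGraph.gridGraph ((2 * k + 2) ^ 2) ((2 * k + 1) ^ 2)).fracDim) := by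
  have hdim : ∀ k : ℕ, 1 < k →
      (SimpleGraph.gridGraph ((2 * k + 2) ^ 2) ((2 * k + 1) ^ 2)).fracDim = 2 := fun k hk =>
    SimpleGraph.fracDim_gridGraph (by nlinarith) (by nlinarith)
  refine ⟨⟨4, 784, by norm_num, by norm_num, fun k hk =>
      ⟨SimpleGraph.le_truncFracDim_squareGrid k, SimpleGraph.truncFracDim_squareGrid_le hk⟩⟩,
    hdim,
    ⟨1, 81, by norm_num, by norm_num, fun k hk =>
      ⟨by rw [one_mul]; exact SimpleGraph.le_truncFracDim_one_squareGrid k,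
        SimpleGraph.truncFracDim_one_squareGrid_le hk⟩⟩, fun M => ?_⟩
  -- The first ratio is at least `k ^ 2 / 784` and the second at least `2 * k ^ 2`.
  obtain ⟨n, hn⟩ := exists_nat_gt (784 * |M|)
  have hM := le_abs_self M
  have hk : 1 < n + 2 := by omega
  refine ⟨n + 2, hk, ?_, ?_⟩
  all_goals
    have h1 := SimpleGraph.le_truncFracDim_squareGrid (n + 2)
    have h2 := SimpleGraph.truncFracDim_squareGrid_le hk
    have h3 := SimpleGraph.le_truncFracDim_one_squareGrid (n + 2)
    have hK : 784 * |M| + 2 < ((n + 2 : ℕ) : ℝ) := by push_cast; linarith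
    have h0 := abs_nonneg M
    generalize ((n + 2 : ℕ) : ℝ) = K at h1 h2 h3 hK
    have hK2 : 784 * |M| < K ^ 2 := by nlinarith
  · rw [lt_div_iff₀ (by nlinarith)]
    calc M * _ ≤ |M| * _ := mul_le_mul_of_nonneg_right hM (by nlinarith)
      _ ≤ |M| * (784 * K ^ 2) := mul_le_mul_of_nonneg_left h2 h0
      _ = (784 * |M|) * K ^ 2 := by ring
      _ < K ^ 2 * K ^ 2 := mul_lt_mul_of_pos_right hK2 (by nlinarith)
      _ = K ^ 4 := by ring
      _ ≤ _ := h3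
  · rw [hdim (n + 2) hk, lt_div_iff₀ (by norm_num)]
    linarith
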